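/- For $0<a\le 1$ let $\zeta(s,a)$ denote the Hurwitz zeta function, that is, $\zeta(s,a)=\sum_{n=0}^{\infty}(n+a)^{-s}$ for $\operatorname{Re}(s)>1$, continued analytically to $\mathbb{C}\setminus\{1\}$, and let $B_j$ be the Bernoulli numbers, defined by $\frac{z}{e^z-1}=\sum_{j=0}^{\infty}\frac{B_j z^j}{j!}$ for $|z|<2\pi$. Let $m$ be a nonzero integer, and let $\alpha,\beta$ be complex numbers with positive real part (in particular, positive real numbers) such that $\alpha\beta=\pi^2$. Then the two infinite series below converge absolutely, and $$\begin{aligned} &\alpha^{-m}\left\{\frac12\,\zeta\!\left(2m+1,\tfrac12\right)-2^{2m+1}\sum_{j=1}^{\infty}\frac{(2j-1)^{-2m-1}}{e^{(2j-1)\alpha}+1}\right\}\\ &\quad=(-\beta)^{-m}\left\{\frac12\,\zeta\!\left(2m+1,\tfrac12\right)-2^{2m+1}\sum_{j=1}^{\infty}\frac{(2j-1)^{-2m-1}}{e^{(2j-1)\beta}+1}\right\}\\ &\qquad-2^{2m}\sum_{j=1}^{m}\frac{(-1)^jB_{2j}B_{2m-2j+2}}{(2j)!\,(2m-2j+2)!}\left(2^{2j}-1\right)\left(2^{2m-2j+2}-1\right)\alpha^{m-j+1}\beta^{j},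 \end{aligned}$$ where the last sum is empty, hence equal to $0$, if $m<0$. -/

import Mathlib

namespace LambertSeries

open Complex

/-! ### Elementary facts about `1 / (exp x ± 1)` -/

/-! The two signs of `m` need different arguments. For `m = -p < 0`, put `k = 2p`. The sum over odd
integers combines Lambert series at `x`, `2x`, `4x`, and `ζ(1 - 2p, 1/2)` supplies the constant
terms. So each brace is a multiple of `G(x) - (2^(k-1) + 2) G(2x) + 2^k G(4x)`, with `G` the weight
`k` Eisenstein series. Inversion `z ↦ -1/z` preserves this combination up to a factor
(`eisensteinLambert_combination_transform`). For `m > 0`, half the zeta value supplies `1/2 -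
1/(e^(aα) + 1)` for each odd `a`. Partial fractions turn the brace into `2^(2m+2) ∑ 1 / (a^(2m) (α
a² + β b²))` over odd `a, b` (`hasSum_doubleTerm`). Exchanging `α` and `β` swaps `a` and `b`; a
finite geometric sum reduces the difference to products of sums of inverse even powers, which give
the Bernoulli numbers. -/

lemma norm_exp_neg_lt_one {x : ℂ} (hx : 0 < x.re) : ‖cexp (-x)‖ < 1 := by
  rw [norm_exp]
  simpa using hx

lemma exp_sub_one_ne_zero {x : ℂ} (hx : 0 < x.re) : cexp x - 1 ≠ 0 := by
  intro h
  have h1 : ‖cexp x‖ = 1 := by rw [sub_eq_zero.mp h]; simp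
  rw [norm_exp, Real.exp_eq_one_iff] at h1
  exact hx.ne' h1

lemma exp_add_one_ne_zero {x : ℂ} (hx : 0 < x.re) : cexp x + 1 ≠ 0 := by
  intro h
  have h1 : ‖cexp x‖ = 1 := by rw [eq_neg_of_add_eq_zero_left h]; simp
  rw [norm_exp, Real.exp_eq_one_iff] at h1
  exact hx.ne' h1

lemma one_div_exp_add_one {x : ℂ} (hx : 0 < x.re) :
    1 / (cexp x + 1) = 1 / (cexp x - 1) - 2 / (cexp (2 * x) - 1) := by
  have h1 := exp_sub_one_ne_zero hx
  have h2 := exp_add_one_ne_zero hx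
  have h3 : cexp (2 * x) - 1 = (cexp x - 1) * (cexp x + 1) := by
    rw [two_mul, exp_add]; ring
  rw [h3]
  field_simp
  ring

lemma re_natCast_mul (n : ℕ) (x : ℂ) : ((n : ℂ) * x).re = n * x.re := by
  simp

lemma re_odd_mul_pos (j : ℕ) {x : ℂ} (hx : 0 < x.re) : 0 < (((2 * j + 1 : ℕ) : ℂ) * x).re := by
  rw [re_natCast_mul]
  positivity

/-! ### Lambert series -/

lemma pow_mul_geometric_div_eq (r n : ℕ) (x : ℂ) :
    (n : ℂ) ^ r * cexp (-x) ^ n / (1 - cexp (-x) ^ n) = (n : ℂ) ^ r / (cexp (n * x) - 1) := by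
  have h : cexp (-x) ^ n = (cexp (n * x))⁻¹ := by
    rw [← exp_nat_mul, ← exp_neg]; ring_nf
  rw [h]
  have h0 := exp_ne_zero (n * x)
  have h1 : 1 - (cexp (n * x))⁻¹ = (cexp (n * x) - 1) * (cexp (n * x))⁻¹ := by
    field_simp
  rw [h1, mul_div_mul_right _ _ (inv_ne_zero h0)]

lemma summable_lambert (r : ℕ) {x : ℂ} (hx : 0 < x.re) :
    Summable fun n : ℕ => (n : ℂ) ^ r / (cexp (n * x) - 1) := by
  simpa only [pow_mul_geometric_div_eq] using
    summable_norm_pow_mul_geometric_div_one_sub r (norm_exp_neg_lt_one hx)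

/-- The Lambert series `∑ n ^ r / (exp (n x) - 1)`. -/
noncomputable def lambert (r : ℕ) (x : ℂ) : ℂ := ∑' n : ℕ, (n : ℂ) ^ r / (cexp (n * x) - 1)

lemma hasSum_lambert (r : ℕ) {x : ℂ} (hx : 0 < x.re) :
    HasSum (fun n : ℕ => (n : ℂ) ^ r / (cexp (n * x) - 1)) (lambert r x) :=
  (summable_lambert r hx).hasSum

lemma re_two_mul_pos {x : ℂ} (hx : 0 < x.re) : 0 < (2 * x).re := by simpa using hx

lemma hasSum_of_even {f : ℕ → ℂ} {a b : ℂ} (hf : HasSum f a)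
    (he : HasSum (fun j => f (2 * j)) b) : HasSum (fun j => f (2 * j + 1)) (a - b) := by
  have ho : Summable fun j => f (2 * j + 1) :=
    hf.summable.comp_injective fun a b h => by simpa using h
  have h := (he.even_add_odd ho.hasSum).unique hf
  rw [← h, add_sub_cancel_left]
  exact ho.hasSum

lemma hasSum_odd_lambert (r : ℕ) {x : ℂ} (hx : 0 < x.re) :
    HasSum (fun j : ℕ => ((2 * j + 1 : ℕ) : ℂ) ^ r / (cexp ((2 * j + 1 : ℕ) * x) - 1))
      (lambert r x - 2 ^ r * lambert r (2 * x)) := by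
  refine hasSum_of_even (hasSum_lambert r hx) ?_
  refine ((hasSum_lambert r (re_two_mul_pos hx)).mul_left (2 ^ r)).congr_fun ?_
  intro j
  push_cast
  rw [mul_pow, mul_div_assoc]
  ring_nf

/-- Termwise `one_div_exp_add_one`, so the odd Lambert sums at `x` and `2x` suffice. -/
lemma hasSum_odd_fermi (r : ℕ) {x : ℂ} (hx : 0 < x.re) :
    HasSum (fun j : ℕ => ((2 * j + 1 : ℕ) : ℂ) ^ r / (cexp ((2 * j + 1 : ℕ) * x) + 1))
      (lambert r x - (2 ^ r + 2) * lambert r (2 * x) + 2 * 2 ^ r * lambert r (4 * x)) := by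
  have h := (hasSum_odd_lambert r hx).sub ((hasSum_odd_lambert r (re_two_mul_pos hx)).mul_left 2)
  convert! h using 1
  · ext j
    rw [div_eq_mul_one_div, one_div_exp_add_one (re_odd_mul_pos j hx),
      show ((2 * j + 1 : ℕ) : ℂ) * (2 * x) = 2 * ((2 * j + 1 : ℕ) * x) by ring]
    ring
  · rw [show (4 : ℂ) * x = 2 * (2 * x) by ring]
    ring

lemma summable_odd_zpow_div_exp_add_one (e : ℤ) {x : ℂ} (hx : 0 < x.re) :
    Summable fun j : ℕ => ((2 * j + 1 : ℕ) : ℂ) ^ e / (cexp ((2 * j + 1 : ℕ) * x) + 1) := by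
  -- The bases are at least `1`, so raising `e` to `e.toNat` only enlarges the norms.
  refine Summable.of_norm_bounded (hasSum_odd_fermi e.toNat hx).summable.norm fun j => ?_
  rw [norm_div, norm_div]
  gcongr
  rw [norm_zpow, norm_pow, norm_natCast, ← zpow_natCast]
  exact zpow_le_zpow_right₀ (by norm_cast; omega) (Int.self_le_toNat e)

/-! ### Modular transformation of Lambert series -/

lemma tsum_sigma_eq_lambert {r : ℕ} (hr : r ≠ 0) (z : UpperHalfPlane) :
    ∑' n : ℕ+, (ArithmeticFunction.sigma r n : ℂ) * cexp (2 * Real.pi * I * z) ^ (n : ℕ) =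
      lambert r (-(2 * Real.pi * I * z)) := by
  rw [← tsum_pow_div_one_sub_eq_tsum_sigma (UpperHalfPlane.norm_exp_two_pi_I_lt_one z) r, lambert]
  have h (n : ℕ) := pow_mul_geometric_div_eq r n (-(2 * Real.pi * I * z))
  simp only [neg_neg] at h
  simp only [← h]
  rw [← tsum_zero_pnat_eq_tsum_nat (f := fun n : ℕ => (n : ℂ) ^ r *
    cexp (2 * Real.pi * I * z) ^ n / (1 - cexp (2 * Real.pi * I * z) ^ n))
    (summable_norm_pow_mul_geometric_div_one_sub r (UpperHalfPlane.norm_exp_two_pi_I_lt_one z))]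
  simp [hr]

/-- The level one Eisenstein series of weight `k`, written as a Lambert series in `x = -2πiz`. -/
noncomputable def eisensteinLambert (k : ℕ) (x : ℂ) : ℂ :=
  2 * riemannZeta k +
    2 * ((-2 * Real.pi * I) ^ k / (k - 1).factorial) * lambert (k - 1) x

-- Right multiplication by `S` permutes `ℤ²`; only the automorphy factor remains.
open ModularGroup in
lemma tsum_eisSummand_S_smul {k : ℕ} (z : UpperHalfPlane) :
    ∑' v, EisensteinSeries.eisSummand k v (S • z) =
      (z : ℂ) ^ k * ∑' v, EisensteinSeries.eisSummand k v z := by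
  have hd : UpperHalfPlane.denom S z = z := by
    rw [ModularGroup.denom_apply]; simp [S]
  simp only [EisensteinSeries.eisSummand_SL2_apply, hd, tsum_mul_left, zpow_natCast]
  congr 1
  let e : (Fin 2 → ℤ) ≃ (Fin 2 → ℤ) :=
    { toFun := fun v => Matrix.vecMul v S.1
      invFun := fun v => Matrix.vecMul v (S⁻¹).1
      left_inv := fun v => by
        simp only [Matrix.vecMul_vecMul]
        rw [← Matrix.SpecialLinearGroup.coe_mul, mul_inv_cancel]
        simp
      right_inv := fun v => by
        simp only [Matrix.vecMul_vecMul]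
        rw [← Matrix.SpecialLinearGroup.coe_mul, inv_mul_cancel]
        simp }
  exact e.tsum_eq (fun v => EisensteinSeries.eisSummand k v z)

-- Weight 2 is not absolutely convergent and goes through `G2`, whose anomaly is the extra term.
open ModularGroup in
lemma eisensteinLambert_S_smul {k : ℕ} (hk : 2 ≤ k) (hk2 : Even k) (z : UpperHalfPlane) :
    eisensteinLambert k (-(2 * Real.pi * I * (S • z : UpperHalfPlane))) =
      (z : ℂ) ^ k * eisensteinLambert k (-(2 * Real.pi * I * z)) -
        if k = 2 then 2 * Real.pi * I * z else 0 := by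
  rcases hk.eq_or_lt with rfl | hk3
  · have key (w : UpperHalfPlane) : eisensteinLambert 2 (-(2 * Real.pi * I * w)) =
        EisensteinSeries.G2 w := by
      rw [EisensteinSeries.G2_eq_tsum_cexp, tsum_sigma_eq_lambert one_ne_zero, eisensteinLambert]
      simp only [mul_pow, I_sq]
      norm_num
      ring
    have hz := UpperHalfPlane.ne_zero z
    rw [key, key, EisensteinSeries.G2_S_transform z]
    simp only [if_true]
    field_simp
    ring
  · have key (w : UpperHalfPlane) : eisensteinLambert k (-(2 * Real.pi * I * w)) =
        ∑' v, EisensteinSeries.eisSummand k v w := by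
      rw [tsum_eisSummand_eq_tsum_sigma_mul_cexp_pow hk3 hk2,
        tsum_sigma_eq_lambert (by omega), eisensteinLambert]
    rw [key, key, tsum_eisSummand_S_smul, if_neg hk3.ne', sub_zero]

lemma eisensteinLambert_transform {k : ℕ} (hk : 2 ≤ k) (hk2 : Even k) {x y : ℂ} (hx : 0 < x.re)
    (hxy : x * y = 4 * (Real.pi : ℂ) ^ 2) :
    eisensteinLambert k y =
      (I * x / (2 * Real.pi)) ^ k * eisensteinLambert k x +
        if k = 2 then x else 0 := by
  have hpi : (Real.pi : ℂ) ≠ 0 := ofReal_ne_zero.mpr Real.pi_ne_zero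
  have hx0 : x ≠ 0 := by rintro rfl; simp at hx
  have him : 0 < (I * x / (2 * Real.pi)).im := by
    rw [show I * x / (2 * Real.pi) = ((1 / (2 * Real.pi) : ℝ) : ℂ) * (I * x) by
      push_cast; field_simp, im_ofReal_mul]
    simpa using by positivity
  set z : UpperHalfPlane := ⟨I * x / (2 * Real.pi), him⟩ with hz
  have hzc : (z : ℂ) = I * x / (2 * Real.pi) := rfl
  have h := eisensteinLambert_S_smul hk hk2 z
  have e1 : -(2 * Real.pi * I * (z : ℂ)) = x := by
    rw [hzc]; field_simp; rw [I_sq]; ring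
  have e2 : -(2 * Real.pi * I * ((ModularGroup.S • z : UpperHalfPlane) : ℂ)) = y := by
    rw [UpperHalfPlane.modular_S_smul]
    simp only [hzc]
    have hy : y = 4 * (Real.pi : ℂ) ^ 2 / x := by field_simp; rw [mul_comm]; exact hxy
    rw [hy]
    field_simp
    ring
  rw [e2, e1, hzc] at h
  rw [h, sub_eq_add_neg]
  congr 1
  split_ifs
  · rw [← hzc, e1]
  · simp

/-- Inversion pairs `y` with `4x`, `2y` with `2x` and `4y` with `x`, so the outer terms trade
places. In weight 2 the anomalies cancel: `4x - 4·2x + 4·x = 0`. -/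
lemma eisensteinLambert_combination_transform {k : ℕ} (hk : 2 ≤ k) (hk2 : Even k) {x y : ℂ}
    (hx : 0 < x.re) (hxy : x * y = (Real.pi : ℂ) ^ 2) :
    eisensteinLambert k y - (2 ^ (k - 1) + 2) * eisensteinLambert k (2 * y) +
        2 * 2 ^ (k - 1) * eisensteinLambert k (4 * y) =
      (I * x / Real.pi) ^ k * (eisensteinLambert k x -
        (2 ^ (k - 1) + 2) * eisensteinLambert k (2 * x) +
        2 * 2 ^ (k - 1) * eisensteinLambert k (4 * x)) := by
  have hpi : (Real.pi : ℂ) ≠ 0 := ofReal_ne_zero.mpr Real.pi_ne_zero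
  have h1 := eisensteinLambert_transform hk hk2 (x := 4 * x) (y := y) (by simpa using hx)
    (by linear_combination 4 * hxy)
  have h2 := eisensteinLambert_transform hk hk2 (x := 2 * x) (y := 2 * y) (by simpa using hx)
    (by linear_combination 4 * hxy)
  have h4 := eisensteinLambert_transform hk hk2 (x := x) (y := 4 * y) hx
    (by linear_combination 4 * hxy)
  rw [h1, h2, h4]
  have e1 : I * (4 * x) / (2 * Real.pi) = 2 * (I * x / Real.pi) := by ring
  have e2 : I * (2 * x) / (2 * Real.pi) = I * x / Real.pi := by field_simp
  have e4 : I * x / (2 * Real.pi) = (I * x / Real.pi) / 2 := by ring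
  rw [e1, e2, e4, mul_pow, div_pow _ (2 : ℂ)]
  obtain ⟨r, rfl⟩ : ∃ r, k = r + 1 := ⟨k - 1, by omega⟩
  have h20 : (2 : ℂ) ^ r ≠ 0 := pow_ne_zero _ two_ne_zero
  simp only [Nat.add_sub_cancel]
  split_ifs with hr
  · obtain rfl : r = 1 := by omega
    field_simp
    ring
  · rw [pow_succ (2 : ℂ) r]
    field_simp
    ring

lemma riemannZeta_two_mul_nat_eq_bernoulli {p : ℕ} (hp : p ≠ 0) :
    2 * riemannZeta (2 * p : ℕ) = -(bernoulli (2 * p) / (2 * (2 * p : ℕ))) *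
      (2 * ((-2 * Real.pi * I) ^ (2 * p) / (2 * p - 1).factorial)) := by
  obtain ⟨q, rfl⟩ : ∃ q, p = q + 1 := ⟨p - 1, by omega⟩
  push_cast
  rw [show (2 * ((q : ℂ) + 1)) = 2 * ((q + 1 : ℕ) : ℂ) by push_cast; ring,
    riemannZeta_two_mul_nat hp]
  rw [show 2 * (q + 1) - 1 = 2 * q + 1 by omega, show 2 * (q + 1) = 2 * q + 1 + 1 by ring,
    Nat.factorial_succ]
  have hf : ((2 * q + 1).factorial : ℂ) ≠ 0 :=
    Nat.cast_ne_zero.mpr (Nat.factorial_ne_zero _)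
  have hI : (-2 * Real.pi * I) ^ (2 * q + 1 + 1) =
      (-1) ^ (q + 1) * (2 * 2 ^ (2 * q + 1)) * (Real.pi : ℂ) ^ (2 * q + 1 + 1) := by
    rw [mul_pow, mul_pow, show 2 * q + 1 + 1 = 2 * (q + 1) by ring, pow_mul I, I_sq,
      pow_mul (-2 : ℂ)]
    rw [show (2:ℂ) * 2 ^ (2 * q + 1) = 2 ^ (2 * (q + 1)) by ring, pow_mul (2 : ℂ)]
    norm_num
    ring
  rw [hI]
  have hq : ((2 * q + 1 + 1 : ℕ) : ℂ) ≠ 0 := Nat.cast_ne_zero.mpr (Nat.succ_ne_zero _)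
  push_cast at hq ⊢
  have hq' : (q : ℂ) + 1 ≠ 0 := by exact_mod_cast Nat.succ_ne_zero q
  field_simp
  ring

lemma hurwitzZeta_half_one_sub_two_mul {p : ℕ} (hp : p ≠ 0) :
    HurwitzZeta.hurwitzZeta ((1 / 2 : ℝ) : UnitAddCircle) (1 - 2 * p) =
      -((2 / 2 ^ (2 * p) - 1) * bernoulli (2 * p) / (2 * p)) := by
  have h := HurwitzZeta.hurwitzZeta_neg_nat (k := 2 * p - 1) (x := 1 / 2) (by omega)
    ⟨by norm_num, by norm_num⟩
  have hc : ((2 * p - 1 : ℕ) : ℂ) = 2 * p - 1 := by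
    rw [Nat.cast_sub (by omega)]; push_cast; ring
  rw [hc, Nat.sub_add_cancel (by omega), neg_sub, sub_add_cancel] at h
  rw [h]
  have h2 := congrArg (fun t : ℝ => (t : ℂ)) (bernoulliFun_eval_half (2 * p))
  have h3 : ((bernoulliFun (2 * p) 2⁻¹ : ℝ) : ℂ) =
      ((Polynomial.bernoulli (2 * p)).map (algebraMap ℚ ℂ)).eval (((1 / 2 : ℝ)) : ℂ) := by
    rw [bernoulliFun, one_div, Polynomial.eval_map_algebraMap, Polynomial.eval_map_algebraMap]
    exact (Polynomial.aeval_algebraMap_apply ℂ (2⁻¹ : ℝ) _).symm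
  rw [← h3, h2]
  push_cast
  ring

/-- The Hurwitz zeta value `ζ(1 - 2p, 1/2)` completes the sum over odd integers to a combination of
Eisenstein series. -/
lemma hurwitzZeta_half_sub_tsum_fermi {p : ℕ} (hp : p ≠ 0) {x : ℂ} (hx : 0 < x.re) :
    2 * ((-2 * Real.pi * I) ^ (2 * p) / (2 * p - 1).factorial) * 2 ^ (2 * p - 1) *
      (1 / 2 * HurwitzZeta.hurwitzZeta ((1 / 2 : ℝ) : UnitAddCircle) (1 - 2 * p) -
        1 / 2 ^ (2 * p - 1) * ∑' j : ℕ, ((2 * j + 1 : ℕ) : ℂ) ^ (2 * p - 1) /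
          (cexp ((2 * j + 1 : ℕ) * x) + 1)) =
      -(eisensteinLambert (2 * p) x - (2 ^ (2 * p - 1) + 2) * eisensteinLambert (2 * p) (2 * x) +
        2 * 2 ^ (2 * p - 1) * eisensteinLambert (2 * p) (4 * x)) := by
  rw [(hasSum_odd_fermi _ hx).tsum_eq, hurwitzZeta_half_one_sub_two_mul hp]
  simp only [eisensteinLambert]
  rw [riemannZeta_two_mul_nat_eq_bernoulli hp]
  set K : ℂ := 2 * ((-2 * Real.pi * I) ^ (2 * p) / (2 * p - 1).factorial)
  have h2 : (2 : ℂ) ^ (2 * p) = 2 * 2 ^ (2 * p - 1) := by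
    rw [← pow_succ', Nat.sub_add_cancel (by omega)]
  rw [h2]
  have h20 : (2 : ℂ) ^ (2 * p - 1) ≠ 0 := pow_ne_zero _ two_ne_zero
  have hp0 : (p : ℂ) ≠ 0 := Nat.cast_ne_zero.mpr hp
  push_cast
  field_simp
  ring

lemma fermi_transform_of_neg {p : ℕ} (hp : p ≠ 0) {α β : ℂ} (hα : 0 < α.re) (hβ : 0 < β.re)
    (hαβ : α * β = (Real.pi : ℂ) ^ 2) :
    α ^ p * (1 / 2 * HurwitzZeta.hurwitzZeta ((1 / 2 : ℝ) : UnitAddCircle) (1 - 2 * p) -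
        1 / 2 ^ (2 * p - 1) * ∑' j : ℕ, ((2 * j + 1 : ℕ) : ℂ) ^ (2 * p - 1) /
          (cexp ((2 * j + 1 : ℕ) * α) + 1)) =
      (-β) ^ p * (1 / 2 * HurwitzZeta.hurwitzZeta ((1 / 2 : ℝ) : UnitAddCircle) (1 - 2 * p) -
        1 / 2 ^ (2 * p - 1) * ∑' j : ℕ, ((2 * j + 1 : ℕ) : ℂ) ^ (2 * p - 1) /
          (cexp ((2 * j + 1 : ℕ) * β) + 1)) := by
  have hpi : (Real.pi : ℂ) ≠ 0 := ofReal_ne_zero.mpr Real.pi_ne_zero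
  have hK : 2 * ((-2 * Real.pi * I) ^ (2 * p) / ((2 * p - 1).factorial : ℂ)) *
      2 ^ (2 * p - 1) ≠ 0 := by
    have hf : ((2 * p - 1).factorial : ℂ) ≠ 0 := Nat.cast_ne_zero.mpr (Nat.factorial_ne_zero _)
    have hI : -2 * Real.pi * I ≠ 0 := by simp [hpi]
    exact mul_ne_zero (mul_ne_zero two_ne_zero (div_ne_zero (pow_ne_zero _ hI) hf))
      (pow_ne_zero _ two_ne_zero)
  have h := eisensteinLambert_combination_transform (k := 2 * p) (by omega) (even_two_mul p) hα hαβ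
  have ha := hurwitzZeta_half_sub_tsum_fermi hp hα
  have hb := hurwitzZeta_half_sub_tsum_fermi hp hβ
  -- Since `π² = αβ`, the square of `Iα/π` is `-α/β`.
  have hc : α ^ p = (-β) ^ p * (I * α / Real.pi) ^ (2 * p) := by
    rw [pow_mul, ← mul_pow]
    congr 1
    rw [div_pow, mul_pow, I_sq, ← hαβ]
    have ha0 : α ≠ 0 := by rintro rfl; simp at hα
    have hb0 : β ≠ 0 := by rintro rfl; simp at hβ
    field_simp
  apply mul_left_cancel₀ hK
  rw [mul_left_comm, ha, mul_left_comm, hb, h, hc]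
  ring

/-! ### Partial fractions -/

lemma sq_add_pi_sq_mul_sq_ne_zero {x : ℂ} (hx : 0 < x.re) (t : ℝ) :
    x ^ 2 + (Real.pi : ℂ) ^ 2 * (t : ℂ) ^ 2 ≠ 0 := by
  have h : x ^ 2 + (Real.pi : ℂ) ^ 2 * (t : ℂ) ^ 2 =
      (x + (Real.pi * t : ℝ) * I) * (x - (Real.pi * t : ℝ) * I) := by
    push_cast
    linear_combination ((Real.pi : ℂ) ^ 2 * (t : ℂ) ^ 2) * I_sq
  rw [h]
  refine mul_ne_zero (fun h0 => ?_) (fun h0 => ?_)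
  · have := congrArg re h0
    rw [add_re, re_ofReal_mul, I_re, zero_re] at this
    linarith
  · have := congrArg re h0
    rw [sub_re, re_ofReal_mul, I_re, zero_re] at this
    linarith

/-- The Mittag-Leffler expansion of the cotangent at `ix/(2π)`. -/
lemma hasSum_one_div_exp_sub_one {x : ℂ} (hx : 0 < x.re) :
    HasSum (fun n : ℕ => 2 * x / (x ^ 2 + (Real.pi : ℂ) ^ 2 * ((2 * (n + 1) : ℕ) : ℂ) ^ 2))
      (1 / (cexp x - 1) + 1 / 2 - 1 / x) := by
  have hpi : (Real.pi : ℂ) ≠ 0 := ofReal_ne_zero.mpr Real.pi_ne_zero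
  have hx0 : x ≠ 0 := by rintro rfl; simp at hx
  have him : 0 < (I * x / (2 * Real.pi)).im := by
    rw [show I * x / (2 * Real.pi) = ((1 / (2 * Real.pi) : ℝ) : ℂ) * (I * x) by
      push_cast; field_simp, im_ofReal_mul]
    simpa using by positivity
  have hz := UpperHalfPlane.coe_mem_integerComplement ⟨_, him⟩
  change I * x / (2 * Real.pi) ∈ _ at hz
  have h := (summable_cotTerm hz).hasSum
  have hval : ∑' n, cotTerm (I * x / (2 * Real.pi)) n = _ := (cot_series_rep' hz).symm
  rw [hval] at h
  convert! h.mul_left (-(2 * Real.pi * I))⁻¹ using 1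
  · ext n
    have hn := sq_add_pi_sq_mul_sq_ne_zero hx (2 * (n + 1) : ℕ)
    rw [cotTerm_identity hz]
    have e : (I * x / (2 * Real.pi) + (n + 1)) * (I * x / (2 * Real.pi) - (n + 1)) =
        -(x ^ 2 + (Real.pi : ℂ) ^ 2 * ((2 * (n + 1) : ℕ) : ℂ) ^ 2) / (4 * Real.pi ^ 2) := by
      push_cast
      field_simp
      linear_combination 4 * x ^ 2 * I_sq
    rw [e]
    rw [ofReal_natCast] at hn
    have hI := I_ne_zero
    field_simp
    ring
  · rw [cot_pi_eq_exp_ratio]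
    have e : 2 * Real.pi * I * (I * x / (2 * Real.pi)) = -x := by
      field_simp
      linear_combination I_sq
    have hI := I_ne_zero
    have h1 := exp_sub_one_ne_zero hx
    have h0 := exp_ne_zero x
    rw [e, exp_neg]
    have h3 : ((cexp x)⁻¹ + 1) / (I * (1 - (cexp x)⁻¹)) = -I * ((cexp x + 1) / (cexp x - 1)) := by
      rw [show 1 - (cexp x)⁻¹ = (cexp x - 1) / cexp x by field_simp]
      field_simp
      linear_combination (1 + cexp x) * I_sq
    rw [h3]
    field_simp
    linear_combination (-2 * (cexp x - 1)) * I_sq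

/-- The previous expansion at `2x` runs over all `n ≥ 1`, at `x` over even ones. Adding the index
`0` term `2/x` to both lets the odd part be read off as a difference. -/
lemma hasSum_fermi {x : ℂ} (hx : 0 < x.re) :
    HasSum (fun k : ℕ => 2 * x / (x ^ 2 + (Real.pi : ℂ) ^ 2 * ((2 * k + 1 : ℕ) : ℂ) ^ 2))
      (1 / 2 - 1 / (cexp x + 1)) := by
  have hx0 : x ≠ 0 := by rintro rfl; simp at hx
  set g : ℕ → ℂ := fun k => 2 * x / (x ^ 2 + (Real.pi : ℂ) ^ 2 * (k : ℂ) ^ 2) with hg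
  have hg0 : g 0 = 2 / x := by simp only [hg, Nat.cast_zero]; field_simp; ring
  have h1 : HasSum (fun n => g (n + 1)) (2 / (cexp (2 * x) - 1) + 1 - 1 / x) := by
    convert! (hasSum_one_div_exp_sub_one (re_two_mul_pos hx)).mul_left 2 using 1
    · ext n
      have hn := sq_add_pi_sq_mul_sq_ne_zero hx (n + 1 : ℕ)
      rw [ofReal_natCast] at hn
      have e : (2 * x) ^ 2 + (Real.pi : ℂ) ^ 2 * ((2 * (n + 1) : ℕ) : ℂ) ^ 2 =
          4 * (x ^ 2 + (Real.pi : ℂ) ^ 2 * ((n + 1 : ℕ) : ℂ) ^ 2) := by push_cast; ring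
      rw [e]
      simp only [hg]
      field_simp
      norm_num
    · field_simp
  have h2 : HasSum g (2 / (cexp (2 * x) - 1) + 1 + 1 / x) := by
    convert! h1.zero_add using 1
    rw [hg0]
    ring
  have h3 : HasSum (fun j => g (2 * j)) (1 / (cexp x - 1) + 1 / 2 + 1 / x) := by
    convert! HasSum.zero_add (f := fun j => g (2 * j)) (hasSum_one_div_exp_sub_one hx) using 1
    rw [mul_zero, hg0]
    ring
  convert! hasSum_of_even h2 h3 using 1
  rw [one_div_exp_add_one hx]
  ring

/-! ### Sums of inverse even powers of odd integers -/

lemma hasSum_one_div_odd_pow {k : ℕ} (hk : k ≠ 0) :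
    HasSum (fun n : ℕ => 1 / ((2 * n + 1 : ℕ) : ℂ) ^ (2 * k))
      ((-1) ^ (k + 1) * (2 ^ (2 * k) - 1) * (Real.pi : ℂ) ^ (2 * k) * bernoulli (2 * k) /
        (2 * (2 * k).factorial)) := by
  have h : HasSum (fun n : ℕ => 1 / (n : ℂ) ^ (2 * k))
      ((-1) ^ (k + 1) * 2 ^ (2 * k - 1) * (Real.pi : ℂ) ^ (2 * k) * bernoulli (2 * k) /
        (2 * k).factorial) := by
    have h := Complex.hasSum_ofReal.mpr (hasSum_zeta_nat hk)
    push_cast at h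
    exact h
  convert! hasSum_of_even h (b := _ ) ((h.mul_left (1 / 2 ^ (2 * k))).congr_fun ?_) using 1
  · have h2 : (2 : ℂ) ^ (2 * k) = 2 * 2 ^ (2 * k - 1) := by
      rw [← pow_succ', Nat.sub_add_cancel (by omega)]
    have h20 : (2 : ℂ) ^ (2 * k - 1) ≠ 0 := pow_ne_zero _ two_ne_zero
    have hf : ((2 * k).factorial : ℂ) ≠ 0 := Nat.cast_ne_zero.mpr (Nat.factorial_ne_zero _)
    rw [h2]
    field_simp
  · intro j
    push_cast
    rw [mul_pow]
    field_simp

/-! ### The double series -/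

lemma re_mul_sq_le_norm_add (α : ℂ) {β : ℂ} (hβ : 0 < β.re) (a b : ℕ) :
    α.re * a ^ 2 ≤ ‖α * (a : ℂ) ^ 2 + β * (b : ℂ) ^ 2‖ := by
  refine le_trans ?_ (re_le_norm _)
  have : (α * (a : ℂ) ^ 2 + β * (b : ℂ) ^ 2).re = α.re * a ^ 2 + β.re * b ^ 2 := by
    rw [show α * (a : ℂ) ^ 2 + β * (b : ℂ) ^ 2 =
      ((a ^ 2 : ℝ) : ℂ) * α + ((b ^ 2 : ℝ) : ℂ) * β by push_cast; ring, add_re, re_ofReal_mul,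
      re_ofReal_mul]
    ring
  rw [this]
  nlinarith [sq_nonneg (b : ℝ)]

lemma add_ne_zero_of_re_pos {α β : ℂ} (hα : 0 < α.re) (hβ : 0 < β.re) (a b : ℕ) :
    α * ((2 * a + 1 : ℕ) : ℂ) ^ 2 + β * ((2 * b + 1 : ℕ) : ℂ) ^ 2 ≠ 0 := by
  rw [← norm_pos_iff]
  refine lt_of_lt_of_le ?_ (re_mul_sq_le_norm_add α hβ _ _)
  positivity

/-- The terms of the double series, over pairs of odd integers. -/
noncomputable def doubleTerm (m : ℕ) (α β : ℂ) (q : ℕ × ℕ) : ℂ :=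
  1 / (((2 * q.1 + 1 : ℕ) : ℂ) ^ (2 * m) *
    (α * ((2 * q.1 + 1 : ℕ) : ℂ) ^ 2 + β * ((2 * q.2 + 1 : ℕ) : ℂ) ^ 2))

lemma summable_one_div_odd_pow {k : ℕ} (hk : k ≠ 0) :
    Summable (fun n : ℕ => 1 / ((2 * n + 1 : ℕ) : ℂ) ^ (2 * k)) :=
  (hasSum_one_div_odd_pow hk).summable

lemma summable_doubleTerm {m : ℕ} (hm : m ≠ 0) {α β : ℂ} (hα : 0 < α.re) (hβ : 0 < β.re) :
    Summable (doubleTerm m α β) := by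
  have h1 := (summable_one_div_odd_pow hm).norm
  have h2 := (summable_one_div_odd_pow one_ne_zero).norm
  have h := (h1.mul_of_nonneg h2 (fun _ => norm_nonneg _) (fun _ => norm_nonneg _)).mul_left
    (1 / β.re)
  refine Summable.of_norm_bounded h fun q => ?_
  -- Keeping only `β b²` bounds the term by a product of convergent series in `a^(-2m)` and
  -- `b^(-2)`.
  have hle := re_mul_sq_le_norm_add β hα (2 * q.2 + 1) (2 * q.1 + 1)
  rw [add_comm (β * _)] at hle
  simp only [doubleTerm, norm_div, norm_mul, norm_pow, norm_natCast, norm_one]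
  rw [one_div_mul_one_div, one_div_mul_one_div]
  apply one_div_le_one_div_of_le (by positivity)
  rw [mul_left_comm, mul_one]
  gcongr

/-- The inner sum is `hasSum_fermi` at `aα`; `αβ = π²` makes its denominator `α (α a² + β b²)`. -/
lemma hasSum_doubleTerm {m : ℕ} (hm : m ≠ 0) {α β : ℂ} (hα : 0 < α.re) (hβ : 0 < β.re)
    (hαβ : α * β = (Real.pi : ℂ) ^ 2) :
    HasSum (fun n : ℕ => 1 / ((2 * n + 1 : ℕ) : ℂ) ^ (2 * m + 1) *
        (1 / 2 - 1 / (cexp ((2 * n + 1 : ℕ) * α) + 1)))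
      (2 * ∑' q, doubleTerm m α β q) := by
  refine ((summable_doubleTerm hm hα hβ).hasSum.mul_left 2).prod_fiberwise fun n => ?_
  have hα0 : α ≠ 0 := by rintro rfl; simp at hα
  refine ((hasSum_fermi (re_odd_mul_pos n hα)).mul_left
    (1 / ((2 * n + 1 : ℕ) : ℂ) ^ (2 * m + 1))).congr_fun fun k => ?_
  have h0 := add_ne_zero_of_re_pos hα hβ n k
  have hn : ((2 * n + 1 : ℕ) : ℂ) ≠ 0 := Nat.cast_ne_zero.mpr (Nat.succ_ne_zero _)
  rw [← hαβ, show (((2 * n + 1 : ℕ) : ℂ) * α) ^ 2 + α * β * ((2 * k + 1 : ℕ) : ℂ) ^ 2 =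
    α * (α * ((2 * n + 1 : ℕ) : ℂ) ^ 2 + β * ((2 * k + 1 : ℕ) : ℂ) ^ 2) by ring, doubleTerm]
  field_simp
  ring

lemma hurwitzZeta_half_sub_tsum_eq_double {m : ℕ} (hm : m ≠ 0) {α β : ℂ} (hα : 0 < α.re)
    (hβ : 0 < β.re) (hαβ : α * β = (Real.pi : ℂ) ^ 2) :
    1 / 2 * HurwitzZeta.hurwitzZeta ((1 / 2 : ℝ) : UnitAddCircle) (2 * m + 1) -
        2 ^ (2 * m + 1) * ∑' j : ℕ, 1 / ((2 * j + 1 : ℕ) : ℂ) ^ (2 * m + 1) /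
          (cexp ((2 * j + 1 : ℕ) * α) + 1) =
      2 ^ (2 * m + 2) * ∑' q, doubleTerm m α β q := by
  have hz := HurwitzZeta.hasSum_hurwitzZeta_of_one_lt_re (a := 1 / 2) (s := 2 * m + 1)
    ⟨by norm_num, by norm_num⟩ (by
      have : (0 : ℝ) < m := Nat.cast_pos.mpr (Nat.pos_of_ne_zero hm)
      simpa using this)
  have hz' : HasSum (fun n : ℕ => 2 ^ (2 * m + 1) * (1 / ((2 * n + 1 : ℕ) : ℂ) ^ (2 * m + 1)))
      (HurwitzZeta.hurwitzZeta ((1 / 2 : ℝ) : UnitAddCircle) (2 * m + 1)) := by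
    refine hz.congr_fun fun n => ?_
    rw [show (2 * (m : ℂ) + 1) = ((2 * m + 1 : ℕ) : ℂ) by push_cast; ring, cpow_natCast,
      show (n : ℂ) + ((1 / 2 : ℝ) : ℂ) = ((2 * n + 1 : ℕ) : ℂ) / 2 by push_cast; ring, div_pow]
    have hn : ((2 * n + 1 : ℕ) : ℂ) ≠ 0 := Nat.cast_ne_zero.mpr (Nat.succ_ne_zero _)
    field_simp
  have hs := (summable_odd_zpow_div_exp_add_one (-(2 * m + 1 : ℕ)) hα)
  have hs' : Summable fun j : ℕ => 1 / ((2 * j + 1 : ℕ) : ℂ) ^ (2 * m + 1) /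
      (cexp ((2 * j + 1 : ℕ) * α) + 1) := by
    refine hs.congr fun j => ?_
    rw [zpow_neg, zpow_natCast, one_div]
  have h := (hz'.mul_left (1 / 2)).sub (hs'.hasSum.mul_left (2 ^ (2 * m + 1)))
  have h' := (hasSum_doubleTerm hm hα hβ hαβ).mul_left (2 ^ (2 * m + 1))
  rw [show (2 : ℂ) ^ (2 * m + 2) * ∑' q, doubleTerm m α β q =
    2 ^ (2 * m + 1) * (2 * ∑' q, doubleTerm m α β q) by ring]
  refine h.unique (h'.congr_fun fun n => ?_)
  ring

/-- Geometric series identity for `1 / x` and `-1 / y`. -/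
lemma inv_pow_sub_inv_neg_pow (m : ℕ) {x y : ℂ} (hx : x ≠ 0) (hy : y ≠ 0) (hxy : x + y ≠ 0) :
    (1 / x ^ m - 1 / (-y) ^ m) / (x + y) =
      -∑ j ∈ Finset.Icc 1 m, (1 / x ^ j) * (1 / (-y) ^ (m + 1 - j)) := by
  have hg := (Commute.all (1 / x) (1 / (-y))).geom_sum₂_mul m
  have hs : ∑ j ∈ Finset.Icc 1 m, (1 / x ^ j) * (1 / (-y) ^ (m + 1 - j)) =
      (1 / x) * (1 / (-y)) * ∑ i ∈ Finset.range m, (1 / x) ^ i * (1 / (-y)) ^ (m - 1 - i) := by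
    rw [Finset.mul_sum, Finset.range_eq_Ico, Finset.sum_Ico_eq_sum_range,
      ← Finset.Ico_add_one_right_eq_Icc, Finset.sum_Ico_eq_sum_range]
    refine Finset.sum_congr (by simp) fun i hi => ?_
    rw [Finset.mem_range] at hi
    rw [show m + 1 - (1 + i) = (m - 1 - (0 + i)) + 1 by omega, zero_add, add_comm 1 i]
    simp only [one_div, inv_pow, pow_succ, mul_inv]
    ring
  rw [hs]
  rw [one_div_pow, one_div_pow] at hg
  rw [← hg]
  field_simp
  ring

/-- After the swap both terms share a denominator; apply `inv_pow_sub_inv_neg_pow` with `x = α a²`,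
`y = β b²`. -/
lemma doubleTerm_sub (m : ℕ) {α β : ℂ} (hα : 0 < α.re) (hβ : 0 < β.re) (q : ℕ × ℕ) :
    1 / α ^ m * doubleTerm m α β q - 1 / (-β) ^ m * doubleTerm m β α q.swap =
      -∑ j ∈ Finset.Icc 1 m, 1 / (α ^ j * (-β) ^ (m + 1 - j)) *
        (1 / ((2 * q.1 + 1 : ℕ) : ℂ) ^ (2 * j) *
          (1 / ((2 * q.2 + 1 : ℕ) : ℂ) ^ (2 * (m + 1 - j)))) := by
  have hα0 : α ≠ 0 := by rintro rfl; simp at hα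
  have hβ0 : β ≠ 0 := by rintro rfl; simp at hβ
  have h0 := add_ne_zero_of_re_pos hα hβ q.1 q.2
  have h1 : ((2 * q.1 + 1 : ℕ) : ℂ) ≠ 0 := Nat.cast_ne_zero.mpr (Nat.succ_ne_zero _)
  have h2 : ((2 * q.2 + 1 : ℕ) : ℂ) ≠ 0 := Nat.cast_ne_zero.mpr (Nat.succ_ne_zero _)
  have h := inv_pow_sub_inv_neg_pow m (mul_ne_zero hα0 (pow_ne_zero 2 h1))
    (mul_ne_zero hβ0 (pow_ne_zero 2 h2)) h0
  simp only [doubleTerm, Prod.fst_swap, Prod.snd_swap]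
  rw [add_comm (β * _)]
  set a : ℂ := ((2 * q.1 + 1 : ℕ) : ℂ)
  set b : ℂ := ((2 * q.2 + 1 : ℕ) : ℂ)
  refine Eq.trans ?_ (h.trans ?_)
  · rw [← neg_mul, mul_pow, mul_pow, pow_mul, pow_mul]
    simp only [one_div, mul_inv]
    ring
  · congr 1
    refine Finset.sum_congr rfl fun j _ => ?_
    rw [← neg_mul, mul_pow, mul_pow, pow_mul, pow_mul]
    simp only [one_div, mul_inv]
    ring

lemma tsum_doubleTerm_sub {m : ℕ} (hm : m ≠ 0) {α β : ℂ} (hα : 0 < α.re) (hβ : 0 < β.re) :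
    1 / α ^ m * ∑' q, doubleTerm m α β q - 1 / (-β) ^ m * ∑' q, doubleTerm m β α q =
      -∑ j ∈ Finset.Icc 1 m, 1 / (α ^ j * (-β) ^ (m + 1 - j)) *
        ((∑' n : ℕ, 1 / ((2 * n + 1 : ℕ) : ℂ) ^ (2 * j)) *
          ∑' n : ℕ, 1 / ((2 * n + 1 : ℕ) : ℂ) ^ (2 * (m + 1 - j))) := by
  have hb : HasSum (fun q : ℕ × ℕ => doubleTerm m β α q.swap) (∑' q, doubleTerm m β α q) :=
    ((Equiv.prodComm ℕ ℕ).hasSum_iff (f := doubleTerm m β α)).mpr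
      (summable_doubleTerm hm hβ hα).hasSum
  have h := ((summable_doubleTerm hm hα hβ).hasSum.mul_left (1 / α ^ m)).sub
    (hb.mul_left (1 / (-β) ^ m))
  simp only [doubleTerm_sub m hα hβ] at h
  refine h.unique (HasSum.neg (hasSum_sum fun j hj => HasSum.mul_left _ ?_))
  rw [Finset.mem_Icc] at hj
  have hj1 := summable_one_div_odd_pow (k := j) (by omega)
  have hj2 := summable_one_div_odd_pow (k := m + 1 - j) (by omega)
  have hs := summable_mul_of_summable_norm hj1.norm hj2.norm
  have h' := hj1.hasSum.mul hj2.hasSum hs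
  exact h'

lemma fermi_transform_of_pos {m : ℕ} (hm : m ≠ 0) {α β : ℂ} (hα : 0 < α.re) (hβ : 0 < β.re)
    (hαβ : α * β = (Real.pi : ℂ) ^ 2) :
    1 / α ^ m * (1 / 2 * HurwitzZeta.hurwitzZeta ((1 / 2 : ℝ) : UnitAddCircle) (2 * m + 1) -
        2 ^ (2 * m + 1) * ∑' j : ℕ, 1 / ((2 * j + 1 : ℕ) : ℂ) ^ (2 * m + 1) /
          (cexp ((2 * j + 1 : ℕ) * α) + 1)) =
      1 / (-β) ^ m * (1 / 2 * HurwitzZeta.hurwitzZeta ((1 / 2 : ℝ) : UnitAddCircle) (2 * m + 1) -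
        2 ^ (2 * m + 1) * ∑' j : ℕ, 1 / ((2 * j + 1 : ℕ) : ℂ) ^ (2 * m + 1) /
          (cexp ((2 * j + 1 : ℕ) * β) + 1)) -
      2 ^ (2 * m) *
        ∑ j ∈ Finset.Icc 1 m,
          (-1 : ℂ) ^ j * (bernoulli (2 * j) : ℂ) * (bernoulli (2 * m + 2 - 2 * j) : ℂ) /
            (((2 * j).factorial : ℂ) * ((2 * m + 2 - 2 * j).factorial : ℂ)) *
            ((2 : ℂ) ^ (2 * j) - 1) * ((2 : ℂ) ^ (2 * m + 2 - 2 * j) - 1) *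
            α ^ (m + 1 - j) * β ^ j := by
  have hα0 : α ≠ 0 := by rintro rfl; simp at hα
  have hβ0 : β ≠ 0 := by rintro rfl; simp at hβ
  rw [hurwitzZeta_half_sub_tsum_eq_double hm hα hβ hαβ,
    hurwitzZeta_half_sub_tsum_eq_double hm hβ hα (by rw [mul_comm, hαβ])]
  have key := tsum_doubleTerm_sub hm hα hβ
  have combine (a b A B T R P Q : ℂ) (h1 : a * A - b * B = -T) (h2 : Q * R = P * T) :
      a * (P * A) = b * (P * B) - Q * R := by linear_combination P * h1 + h2
  refine combine _ _ _ _ _ _ _ _ key ?_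
  rw [Finset.mul_sum, Finset.mul_sum]
  refine Finset.sum_congr rfl fun j hj => ?_
  rw [Finset.mem_Icc] at hj
  -- The two odd sums carry `π^(2j) π^(2i) = (αβ)^(j+i)`; dividing by `α^j β^i` leaves `α^i β^j`.
  obtain ⟨i, hi⟩ : ∃ i, m + 1 = j + i := ⟨m + 1 - j, by omega⟩
  rw [show m + 1 - j = i by omega, show 2 * m + 2 - 2 * j = 2 * i by omega,
    (hasSum_one_div_odd_pow (k := j) (by omega)).tsum_eq,
    (hasSum_one_div_odd_pow (k := i) (by omega)).tsum_eq, pow_mul (Real.pi : ℂ),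
    pow_mul (Real.pi : ℂ), ← hαβ, show 2 * m + 2 = 2 * m + 1 + 1 by ring, neg_pow β i]
  have hf1 : ((2 * j).factorial : ℂ) ≠ 0 := Nat.cast_ne_zero.mpr (Nat.factorial_ne_zero _)
  have hf2 : ((2 * i).factorial : ℂ) ≠ 0 := Nat.cast_ne_zero.mpr (Nat.factorial_ne_zero _)
  have hs : (-1 : ℂ) ^ i ≠ 0 := pow_ne_zero _ (by norm_num)
  rw [mul_pow, mul_pow, pow_succ (-1 : ℂ), pow_succ (-1 : ℂ)]
  field_simp
  ring

end LambertSeries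

theorem corollary4p2 (m : ℤ) (hm : m ≠ 0) (α β : ℂ) (hα : 0 < α.re) (hβ : 0 < β.re)
    (hαβ : α * β = (Real.pi : ℂ) ^ 2) :
    Summable (fun j : ℕ => ((2 * j + 1 : ℕ) : ℂ) ^ (-2 * m - 1) /
      (Complex.exp (((2 * j + 1 : ℕ) : ℂ) * α) + 1)) ∧
    Summable (fun j : ℕ => ((2 * j + 1 : ℕ) : ℂ) ^ (-2 * m - 1) /
      (Complex.exp (((2 * j + 1 : ℕ) : ℂ) * β) + 1)) ∧
    α ^ (-m) *
        (1 / 2 * HurwitzZeta.hurwitzZeta ((1 / 2 : ℝ) : UnitAddCircle) (2 * (m : ℂ) + 1) -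
          (2 : ℂ) ^ (2 * m + 1) *
            ∑' j : ℕ, ((2 * j + 1 : ℕ) : ℂ) ^ (-2 * m - 1) /
              (Complex.exp (((2 * j + 1 : ℕ) : ℂ) * α) + 1)) =
      (-β) ^ (-m) *
        (1 / 2 * HurwitzZeta.hurwitzZeta ((1 / 2 : ℝ) : UnitAddCircle) (2 * (m : ℂ) + 1) -
          (2 : ℂ) ^ (2 * m + 1) *
            ∑' j : ℕ, ((2 * j + 1 : ℕ) : ℂ) ^ (-2 * m - 1) /
              (Complex.exp (((2 * j + 1 : ℕ) : ℂ) * β) + 1)) -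
      (2 : ℂ) ^ (2 * m) *
        ∑ j ∈ Finset.Icc 1 m.toNat,
          (-1 : ℂ) ^ j * (bernoulli (2 * j) : ℂ) * (bernoulli (2 * m.toNat + 2 - 2 * j) : ℂ) /
            (((2 * j).factorial : ℂ) * ((2 * m.toNat + 2 - 2 * j).factorial : ℂ)) *
            ((2 : ℂ) ^ (2 * j) - 1) * ((2 : ℂ) ^ (2 * m.toNat + 2 - 2 * j) - 1) *
            α ^ (m.toNat + 1 - j) * β ^ j := by
  refine ⟨LambertSeries.summable_odd_zpow_div_exp_add_one _ hα,
    LambertSeries.summable_odd_zpow_div_exp_add_one _ hβ, ?_⟩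
  obtain ⟨n, rfl | rfl⟩ := m.eq_nat_or_neg
  · have hn : n ≠ 0 := by simpa using hm
    have h := LambertSeries.fermi_transform_of_pos hn hα hβ hαβ
    have e1 : (-2 * (n : ℤ) - 1) = -((2 * n + 1 : ℕ) : ℤ) := by push_cast; ring
    have e2 : (2 * (n : ℤ) + 1) = ((2 * n + 1 : ℕ) : ℤ) := by push_cast; ring
    have e3 : (2 * (n : ℤ)) = ((2 * n : ℕ) : ℤ) := by push_cast; ring
    rw [e1, e2, e3]
    simp only [zpow_neg, zpow_natCast, Int.toNat_natCast, Int.cast_natCast, ← one_div]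
    exact h
  · have hn : n ≠ 0 := by simpa using hm
    have h := LambertSeries.fermi_transform_of_neg hn hα hβ hαβ
    have e1 : (-2 * (-(n : ℤ)) - 1) = ((2 * n - 1 : ℕ) : ℤ) := by
      rw [Nat.cast_sub (by omega)]; push_cast; ring
    have e2 : (2 * (-(n : ℤ)) + 1) = -((2 * n - 1 : ℕ) : ℤ) := by
      rw [Nat.cast_sub (by omega)]; push_cast; ring
    have e3 : 2 * ((-(n : ℤ) : ℤ) : ℂ) + 1 = 1 - 2 * n := by push_cast; ring
    -- Truncation at `0` makes the Bernoulli sum empty.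
    have e4 : (-(n : ℤ)).toNat = 0 := by simp
    rw [e1, e2, e3, e4]
    simp only [neg_neg, zpow_neg, zpow_natCast, ← one_div]
    simpa using h
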